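/- Let $\mathcal H_1,\mathcal H_2,\mathcal H_3$ be (real or complex) Hilbert spaces, and let $A\in\mathcal B(\mathcal H_2,\mathcal H_3)$ and $B\in\mathcal B(\mathcal H_1,\mathcal H_2)$ be bounded operators such that $A$, $B$ and $AB$ have closed ranges. For a bounded operator $T$ consider the Penrose equations for a bounded operator $X$: (i) $TXT=T$; (ii) $XTX=X$; (iii) $(TX)^*=TX$; (iv) $(XT)^*=XT$. The Moore–Penrose inverse $T^\dagger$ is the unique $X$ satisfying (i)–(iv), if it exists, and $T\{1,3,4\}$ is the set of all $X$ satisfying (i), (iii), (iv). Write $T^{\dagger*}=(T^\dagger)^*$. Let $m,n\ge 0$ be integers. Then all Moore–Penrose inverses written below exist, and the following statements are equivalent: 1. $(AB)^\dagger=B^\dagger A^\dagger$; 2. $B(AB)^\dagger A=BB^\dagger A^\dagger A$; 3. $AA^*(B^*A^*)^\dagger B^*B=AB$; 4. $(AB)^\dagger=B^\dagger A^\dagger ABB^\dagger A^\dagger$; 5. $(AB)^\dagger=(A^\dagger AB)^\dagger A^\dagger$ and $(A^\dagger AB)^\dagger=B^\dagger A^\dagger A$; 6. $(AB)^\dagger=B^\dagger(ABB^\dagger)^\dagger$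 and $(ABB^\dagger)^\dagger=BB^\dagger A^\dagger$; 7. $(AB)^\dagger=B^\dagger(A^\dagger ABB^\dagger)^\dagger A^\dagger$ and $(A^\dagger ABB^\dagger)^\dagger=BB^\dagger A^\dagger A$; 8. $B^\dagger A^\dagger\in AB\{1,3,4\}$; 9. $AB(AB)^\dagger=ABB^\dagger A^\dagger=A^{\dagger*}BB^\dagger A^*$ and $(AB)^\dagger AB=B^\dagger A^\dagger AB=B^*A^\dagger AB^{\dagger*}$; 10. $(A^{\dagger*}B)^\dagger=B^\dagger A^*$; 11. $A^\dagger(B^*A^\dagger)^\dagger B^*=A^\dagger ABB^\dagger$; 12. $AA^\dagger(B^*A^\dagger)^\dagger B^*B=AB$; 13. $(A^{\dagger*}B)^\dagger=B^\dagger A^\dagger ABB^\dagger A^*$; 14. $(A^{\dagger*}B)^\dagger=(A^\dagger AB)^\dagger A^*$ and $(A^\dagger AB)^\dagger=B^\dagger A^\dagger A$; 15. $(A^{\dagger*}B)^\dagger=B^\dagger(A^{\dagger*}BB^\dagger)^\dagger$ and $(A^{\dagger*}BB^\dagger)^\dagger=BB^\dagger A^*$; 16. $(A^{\dagger*}B)^\dagger=B^\dagger(A^\dagger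 ABB^\dagger)^\dagger A^*$ and $(A^\dagger ABB^\dagger)^\dagger=BB^\dagger A^\dagger A$; 17. $B^\dagger A^*\in A^{\dagger*}B\{1,3,4\}$; 18. $(B^*A^\dagger)^\dagger B^*A^\dagger=ABB^\dagger A^\dagger=A^{\dagger*}BB^\dagger A^*$ and $B^*A^\dagger(B^*A^\dagger)^\dagger=B^\dagger A^\dagger AB=B^*A^\dagger AB^{\dagger*}$; 19. $(AB^{\dagger*})^\dagger=B^*A^\dagger$; 20. $B^{\dagger*}(AB^{\dagger*})^\dagger A=BB^\dagger A^\dagger A$; 21. $AA^*(B^\dagger A^*)^\dagger B^\dagger B=AB$; 22. $(AB^{\dagger*})^\dagger=B^*A^\dagger ABB^\dagger A^\dagger$; 23. $(AB^{\dagger*})^\dagger=(A^\dagger AB^{\dagger*})^\dagger A^\dagger$ and $(A^\dagger AB^{\dagger*})^\dagger=B^*A^\dagger A$; 24. $(AB^{\dagger*})^\dagger=B^*(ABB^\dagger)^\dagger$ and $(ABB^\dagger)^\dagger=BB^\dagger A^\dagger$; 25. $(AB^{\dagger*})^\dagger=B^*(A^\dagger ABB^\dagger)^\dagger A^\dagger$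 and $(A^\dagger ABB^\dagger)^\dagger=BB^\dagger A^\dagger A$; 26. $B^*A^\dagger\in AB^{\dagger*}\{1,3,4\}$; 27. $(B^\dagger A^*)^\dagger B^\dagger A^*=ABB^\dagger A^\dagger=A^{\dagger*}BB^\dagger A^*$ and $B^\dagger A^*(B^\dagger A^*)^\dagger=B^\dagger A^\dagger AB=B^*A^\dagger AB^{\dagger*}$; 28. $(B^\dagger A^\dagger)^\dagger=AB$; 29. $A^\dagger(B^\dagger A^\dagger)^\dagger B^\dagger=A^\dagger ABB^\dagger$; 30. $(AA^*)^\dagger(B^\dagger A^\dagger)^\dagger(B^*B)^\dagger=A^{\dagger*}B^{\dagger*}$; 31. $(B^\dagger A^\dagger)^\dagger=ABB^\dagger A^\dagger AB$; 32. $(B^\dagger A^\dagger)^\dagger=A(B^\dagger A^\dagger A)^\dagger$ and $(B^\dagger A^\dagger A)^\dagger=A^\dagger AB$; 33. $(B^\dagger A^\dagger)^\dagger=(BB^\dagger A^\dagger)^\dagger B$ and $(BB^\dagger A^\dagger)^\dagger=ABB^\dagger$; 34. $(B^\dagger A^\dagger)^\dagger=A(BB^\dagger A^\dagger A)^\dagger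 B$ and $(BB^\dagger A^\dagger A)^\dagger=A^\dagger ABB^\dagger$; 35. $AB\in B^\dagger A^\dagger\{1,3,4\}$; 36. $B^\dagger A^\dagger(B^\dagger A^\dagger)^\dagger=B^\dagger A^\dagger AB=B^*A^\dagger AB^{\dagger*}$ and $(B^\dagger A^\dagger)^\dagger B^\dagger A^\dagger=ABB^\dagger A^\dagger=A^{\dagger*}BB^\dagger A^*$; 37. $(AB)^\dagger=(A^*AB)^\dagger A^*$ and $(A^*AB)^\dagger=B^\dagger(A^*A)^\dagger$; 38. $(AB)^\dagger=B^*(ABB^*)^\dagger$ and $(ABB^*)^\dagger=(BB^*)^\dagger A^\dagger$; 39. $(AB)^\dagger=B^*(A^*ABB^*)^\dagger A^*$ and $(A^*ABB^*)^\dagger=(BB^*)^\dagger(A^*A)^\dagger$; 40. $(AB)^\dagger=(B^*B)^n\big((AA^*)^mAB(B^*B)^n\big)^\dagger(AA^*)^m$ and $\big((AA^*)^mAB(B^*B)^n\big)^\dagger=\big(B(B^*B)^n\big)^\dagger\big((AA^*)^mA\big)^\dagger$; 41. $(AB)^\dagger=B^*(BB^*)^n\big((A^*A)^{m+1}(BB^*)^{n+1}\big)^\dagger(A^*A)^mA^*$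 and $\big((A^*A)^{m+1}(BB^*)^{n+1}\big)^\dagger=\big((BB^*)^\dagger\big)^{n+1}\big((A^*A)^\dagger\big)^{m+1}$. -/

import Mathlib

set_option maxHeartbeats 1000000

section PenroseEquations

variable {𝕜 E F : Type*} [RCLike 𝕜]
  [NormedAddCommGroup E] [InnerProductSpace 𝕜 E] [CompleteSpace E]
  [NormedAddCommGroup F] [InnerProductSpace 𝕜 F] [CompleteSpace F]

/-- First Penrose equation `A X A = A`. -/
def Penrose1 (A : E →L[𝕜] F) (X : F →L[𝕜] E) : Prop := A ∘L X ∘L A = A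

/-- Second Penrose equation `X A X = X`. -/
def Penrose2 (A : E →L[𝕜] F) (X : F →L[𝕜] E) : Prop := X ∘L A ∘L X = X

/-- Third Penrose equation `(A X)* = A X`. -/
def Penrose3 (A : E →L[𝕜] F) (X : F →L[𝕜] E) : Prop :=
  ContinuousLinearMap.adjoint (A ∘L X) = A ∘L X

/-- Fourth Penrose equation `(X A)* = X A`. -/
def Penrose4 (A : E →L[𝕜] F) (X : F →L[𝕜] E) : Prop :=
  ContinuousLinearMap.adjoint (X ∘L A) = X ∘L A

/-- The set `A{1,3,4}` of all `{1,3,4}`-generalized inverses of `A`. -/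
def inverses134 (A : E →L[𝕜] F) : Set (F →L[𝕜] E) :=
  {X | Penrose1 A X ∧ Penrose3 A X ∧ Penrose4 A X}

/-- `X` is a Moore-Penrose inverse of `A`: all four Penrose equations hold. -/
def IsMoorePenrose (A : E →L[𝕜] F) (X : F →L[𝕜] E) : Prop :=
  Penrose1 A X ∧ Penrose2 A X ∧ Penrose3 A X ∧ Penrose4 A X

/-- `A` has a (bounded) Moore-Penrose inverse. -/
def HasMoorePenrose (A : E →L[𝕜] F) : Prop := ∃ X : F →L[𝕜] E, IsMoorePenrose A X

open Classical in
/-- The Moore-Penrose inverse of `A` (and `0` when `A` has none). -/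
noncomputable def mpInv (A : E →L[𝕜] F) : F →L[𝕜] E :=
  if h : HasMoorePenrose A then h.choose else 0

theorem mpInv_spec {A : E →L[𝕜] F} (h : HasMoorePenrose A) : IsMoorePenrose A (mpInv A) := by
  rw [mpInv, dif_pos h]
  exact h.choose_spec

theorem IsMoorePenrose.unique {A : E →L[𝕜] F} {X Y : F →L[𝕜] E}
    (hX : IsMoorePenrose A X) (hY : IsMoorePenrose A Y) : X = Y := by
  obtain ⟨x1, x2, x3, x4⟩ := hX
  obtain ⟨y1, y2, y3, y4⟩ := hY
  simp only [Penrose1, Penrose2, Penrose3, Penrose4] at *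
  have hL : A ∘L X = A ∘L Y := by
    have h : (A ∘L Y) ∘L (A ∘L X) = A ∘L X := by
      calc (A ∘L Y) ∘L (A ∘L X) = (A ∘L Y ∘L A) ∘L X := rfl
        _ = A ∘L X := by rw [y1]
    have h' := congrArg ContinuousLinearMap.adjoint h
    rw [ContinuousLinearMap.adjoint_comp, x3, y3] at h'
    calc A ∘L X = (A ∘L X) ∘L (A ∘L Y) := h'.symm
      _ = (A ∘L X ∘L A) ∘L Y := rfl
      _ = A ∘L Y := by rw [x1]
  have hR : X ∘L A = Y ∘L A := by
    have h : (X ∘L A) ∘L (Y ∘L A) = X ∘L A := by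
      calc (X ∘L A) ∘L (Y ∘L A) = X ∘L (A ∘L Y ∘L A) := rfl
        _ = X ∘L A := by rw [y1]
    have h' := congrArg ContinuousLinearMap.adjoint h
    rw [ContinuousLinearMap.adjoint_comp, x4, y4] at h'
    calc X ∘L A = (Y ∘L A) ∘L (X ∘L A) := h'.symm
      _ = Y ∘L (A ∘L X ∘L A) := rfl
      _ = Y ∘L A := by rw [x1]
  calc X = X ∘L (A ∘L X) := x2.symm
    _ = (X ∘L A) ∘L Y := by rw [hL]; rfl
    _ = Y ∘L A ∘L Y := by rw [hR]; rfl
    _ = Y := y2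

end PenroseEquations

/-- `A†` is the Moore-Penrose inverse of `A`. -/
postfix:max "†" => mpInv

/-- `Aᴴ` is the Hilbert space adjoint of `A`. -/
postfix:max "ᴴ" => ContinuousLinearMap.adjoint

/-!
Write `P = A† A` and `Q = B B†`. Every statement of the list is equivalent to Greville's condition
that `Aᴴ A` commutes with `Q` and `B Bᴴ` commutes with `P` (`GrevilleCondition`).

Greville's condition makes `P` and `Q` commute and makes `A Q A†` and `B† P B` self-adjoint, whence
`B† A†` satisfies the Penrose equations for `A B` (`isMoorePenrose_comp`). Conversely, if `B† A†` is
a `{1,3,4}`-inverse of `A B`, then `W = (1 - P) B Bᴴ Aᴴ` satisfies `Wᴴ W = 0`, so that `B Bᴴ`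
commutes with `P`, and dually (`commGram_adjoint_of_penrose`, `commGram_of_penrose`). The other
formulas for `(A B)†` reduce to `(A B)† = B† A†` by cancellation, because `(A B)†` absorbs `B† B` on
the left and `A A†` on the right. The one exception is `(A B)† = B† P Q A†`, which gives
`(P Q)³ = P Q`; a positivity argument then shows that `P` and `Q` commute
(`comm_of_projection_power`).

The condition involves `A` only through `P` and through the operators commuting with `Aᴴ A`. Hence
it is inherited when `A` is replaced by `P`, by `A†ᴴ`, by `Aᴴ A` or by products of powers
(`Companion`), and similarly for `B` (`Cocompanion`). Moreover, replacing `A` by `A†ᴴ` or `B` by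
`B†ᴴ` gives an equivalent condition, so the same nine equivalences hold for the four products `A B`,
`A†ᴴ B`, `A B†ᴴ` and `A†ᴴ B†ᴴ`; adjoints yield the formulas with reversed factors. Finally the
reverse order law for products of companions gives the formulas with Gram operators and powers.
Existence of all inverses follows from that of `(A B)†`, since every product of companions can be
obtained from `A B` by multiplication with operators that are invertible on the relevant subspaces
(`Companion.hasMoorePenrose_comp`).
-/

open ContinuousLinearMap

section ReverseOrderLaw

variable {𝕜 E F G : Type*} [RCLike 𝕜]
  [NormedAddCommGroup E] [InnerProductSpace 𝕜 E] [CompleteSpace E]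
  [NormedAddCommGroup F] [InnerProductSpace 𝕜 F] [CompleteSpace F]
  [NormedAddCommGroup G] [InnerProductSpace 𝕜 G] [CompleteSpace G]

/-! ### Calculus with Moore-Penrose inverses -/

/-! For a Moore-Penrose inverse `X` of `A`, the lemmas below shorten every word in `A`, `X`, `Aᴴ`, `Xᴴ`
that can be shortened by the Penrose equations. In their names `a'` and `x'` stand for `Aᴴ` and
`Xᴴ`; the versions ending in `_assoc` apply inside a longer composition associated to the right. -/

namespace IsMoorePenrose

variable {A : E →L[𝕜] F} {X : F →L[𝕜] E}

theorem axa (h : IsMoorePenrose A X) : A ∘L X ∘L A = A := h.1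

theorem xax (h : IsMoorePenrose A X) : X ∘L A ∘L X = X := h.2.1

theorem adj_x_adj_a (h : IsMoorePenrose A X) : Xᴴ ∘L Aᴴ = A ∘L X := by
  rw [← adjoint_comp]; exact h.2.2.1

theorem adj_a_adj_x (h : IsMoorePenrose A X) : Aᴴ ∘L Xᴴ = X ∘L A := by
  rw [← adjoint_comp]; exact h.2.2.2

theorem xaa' (h : IsMoorePenrose A X) : X ∘L A ∘L Aᴴ = Aᴴ := by
  rw [← comp_assoc, ← h.adj_a_adj_x, ← adjoint_comp, ← adjoint_comp, h.axa]

theorem a'ax (h : IsMoorePenrose A X) : Aᴴ ∘L A ∘L X = Aᴴ := by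
  rw [← h.adj_x_adj_a, ← comp_assoc, ← adjoint_comp, ← adjoint_comp, h.axa]

theorem axx' (h : IsMoorePenrose A X) : A ∘L X ∘L Xᴴ = Xᴴ := by
  rw [← comp_assoc, ← h.adj_x_adj_a, ← adjoint_comp, ← adjoint_comp, h.xax]

theorem x'xa (h : IsMoorePenrose A X) : Xᴴ ∘L X ∘L A = Xᴴ := by
  rw [← h.adj_a_adj_x, ← comp_assoc, ← adjoint_comp, ← adjoint_comp, h.xax]

variable {K : Type*} [NormedAddCommGroup K] [NormedSpace 𝕜 K] (S : K →L[𝕜] E) (T : K →L[𝕜] F)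

theorem axa_assoc (h : IsMoorePenrose A X) : A ∘L X ∘L A ∘L S = A ∘L S := by
  simpa only [comp_assoc] using congrArg (· ∘L S) h.axa

theorem xax_assoc (h : IsMoorePenrose A X) : X ∘L A ∘L X ∘L T = X ∘L T := by
  simpa only [comp_assoc] using congrArg (· ∘L T) h.xax

theorem adj_x_adj_a_assoc (h : IsMoorePenrose A X) : Xᴴ ∘L Aᴴ ∘L T = A ∘L X ∘L T := by
  simpa only [comp_assoc] using congrArg (· ∘L T) h.adj_x_adj_a

theorem adj_a_adj_x_assoc (h : IsMoorePenrose A X) : Aᴴ ∘L Xᴴ ∘L S = X ∘L A ∘L S := by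
  simpa only [comp_assoc] using congrArg (· ∘L S) h.adj_a_adj_x

theorem xaa'_assoc (h : IsMoorePenrose A X) : X ∘L A ∘L Aᴴ ∘L T = Aᴴ ∘L T := by
  simpa only [comp_assoc] using congrArg (· ∘L T) h.xaa'

theorem a'ax_assoc (h : IsMoorePenrose A X) : Aᴴ ∘L A ∘L X ∘L T = Aᴴ ∘L T := by
  simpa only [comp_assoc] using congrArg (· ∘L T) h.a'ax

theorem axx'_assoc (h : IsMoorePenrose A X) : A ∘L X ∘L Xᴴ ∘L S = Xᴴ ∘L S := by
  simpa only [comp_assoc] using congrArg (· ∘L S) h.axx'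

theorem x'xa_assoc (h : IsMoorePenrose A X) : Xᴴ ∘L X ∘L A ∘L S = Xᴴ ∘L S := by
  simpa only [comp_assoc] using congrArg (· ∘L S) h.x'xa

protected theorem hasMP (h : IsMoorePenrose A X) : HasMoorePenrose A := ⟨X, h⟩

protected theorem mpInv_eq (h : IsMoorePenrose A X) : A† = X :=
  (mpInv_spec h.hasMP).unique h

protected theorem symm (h : IsMoorePenrose A X) : IsMoorePenrose X A :=
  ⟨h.2.1, h.1, h.2.2.2, h.2.2.1⟩

protected theorem adjoint (h : IsMoorePenrose A X) : IsMoorePenrose Aᴴ Xᴴ := by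
  refine ⟨?_, ?_, ?_, ?_⟩
  · rw [Penrose1, ← adjoint_comp, ← adjoint_comp, comp_assoc, h.axa]
  · rw [Penrose2, ← adjoint_comp, ← adjoint_comp, comp_assoc, h.xax]
  · rw [Penrose3, ← adjoint_comp, h.2.2.2, h.2.2.2]
  · rw [Penrose4, ← adjoint_comp, h.2.2.1, h.2.2.1]

end IsMoorePenrose

theorem HasMoorePenrose.adjoint {A : E →L[𝕜] F} (h : HasMoorePenrose A) : HasMoorePenrose Aᴴ :=
  (mpInv_spec h).adjoint.hasMP

theorem HasMoorePenrose.mpInv_adjoint {A : E →L[𝕜] F} (h : HasMoorePenrose A) : Aᴴ† = A†ᴴ :=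
  (mpInv_spec h).adjoint.mpInv_eq

/-! ### Existence of Moore-Penrose inverses -/

/-- A bounded operator with closed range has a Moore-Penrose inverse: by the open mapping theorem
it restricts to an isomorphism from the orthogonal complement of its kernel onto its range. -/
theorem hasMoorePenrose_of_isClosed_range {A : E →L[𝕜] F} (h : IsClosed (Set.range A)) :
    HasMoorePenrose A := by
  have hR : IsClosed (A.range : Set F) := by
    rw [LinearMap.coe_range]; exact h
  have : CompleteSpace A.range := hR.completeSpace_coe
  let N : Submodule 𝕜 E := A.kerᗮ
  have : CompleteSpace A.ker := A.isClosed_ker.completeSpace_coe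
  let f : N →L[𝕜] A.range := (A ∘L N.subtypeL).codRestrict A.range (fun x => ⟨_, rfl⟩)
  have key : ∀ x : E, A (N.starProjection x) = A x := by
    intro x
    have : x - N.starProjection x ∈ A.ker := by
      have := N.sub_starProjection_mem_orthogonal x
      rwa [Submodule.orthogonal_orthogonal] at this
    have : A (x - N.starProjection x) = 0 := this
    rw [map_sub, sub_eq_zero] at this
    exact this.symm
  have hinj : f.ker = ⊥ := by
    rw [LinearMap.ker_eq_bot']
    intro x hx
    have h1 : A x = 0 := congrArg Subtype.val hx
    have h2 : (x : E) ∈ A.ker := h1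
    have h3 := x.2 x h2
    rw [inner_self_eq_zero] at h3
    exact Subtype.ext h3
  have hsurj : f.range = ⊤ := by
    rw [LinearMap.range_eq_top]
    rintro ⟨_, x, rfl⟩
    exact ⟨N.orthogonalProjectionOnto x, Subtype.ext (key x)⟩
  let e := ContinuousLinearEquiv.ofBijective f hinj hsurj
  let X : F →L[𝕜] E := N.subtypeL ∘L (e.symm : A.range →L[𝕜] N) ∘L A.range.orthogonalProjectionOnto
  have hAX : A ∘L X = A.range.starProjection := by
    ext y
    have : e (e.symm (A.range.orthogonalProjectionOnto y)) = A.range.orthogonalProjectionOnto y := by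
      simp
    exact congrArg Subtype.val this
  have hXA : X ∘L A = N.starProjection := by
    ext x
    have h1 : A.range.orthogonalProjectionOnto (A x) = e (N.orthogonalProjectionOnto x) := by
      apply Subtype.ext
      have h2 : (A.range.orthogonalProjectionOnto (A x) : F) = A x :=
        Submodule.starProjection_eq_self_iff.2 ⟨x, rfl⟩
      rw [h2]
      exact (key x).symm
    change ((e.symm (A.range.orthogonalProjectionOnto (A x)) : N) : E) = _
    rw [h1]
    simp
  refine ⟨X, ?_, ?_, ?_, ?_⟩
  · rw [Penrose1, hXA]; ext x; exact key x
  · rw [Penrose2, ← comp_assoc, hXA]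
    ext y
    exact Submodule.starProjection_eq_self_iff.2 (Subtype.mem _)
  · rw [Penrose3, hAX]
    exact isSelfAdjoint_starProjection _
  · rw [Penrose4, hXA]
    exact isSelfAdjoint_starProjection _

/-- An operator with a bounded inner inverse `X` has closed range, namely the fixed space of `A X`,
and hence a Moore-Penrose inverse. -/
theorem hasMoorePenrose_of_penrose1 {A : E →L[𝕜] F} {X : F →L[𝕜] E} (h : Penrose1 A X) :
    HasMoorePenrose A := by
  apply hasMoorePenrose_of_isClosed_range
  have : Set.range A = {y | A (X y) = y} := by
    ext y
    constructor
    · rintro ⟨x, rfl⟩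
      exact DFunLike.congr_fun h x
    · intro hy
      exact ⟨X y, hy⟩
  rw [this]
  exact isClosed_eq (by fun_prop) continuous_id

/-! ### Two consequences of positivity -/

theorem eq_zero_of_adjoint_comp_add_eq_zero {W : E →L[𝕜] F} {V : E →L[𝕜] G}
    (h : Wᴴ ∘L W + Vᴴ ∘L V = 0) : W = 0 := by
  ext x
  have h1 := congrArg (fun T : E →L[𝕜] E => RCLike.re (inner 𝕜 (T x) x)) h
  simp only [add_apply, inner_add_left, map_add, zero_apply, inner_zero_left,
    ← apply_norm_sq_eq_inner_adjoint_left, map_zero] at h1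
  have : ‖W x‖ ^ 2 = 0 := by nlinarith [sq_nonneg ‖W x‖, sq_nonneg ‖V x‖]
  simpa using this

theorem eq_zero_of_adjoint_comp_eq_zero {W : E →L[𝕜] F} (h : Wᴴ ∘L W = 0) : W = 0 :=
  eq_zero_of_adjoint_comp_add_eq_zero (V := (0 : E →L[𝕜] E)) (by simp [h])

/-- Two orthogonal projections with `(P Q)³ = P Q` commute: with `W = (1 - P) Q P` and
`V = (1 - Q) P Q P` one has `Wᴴ W + Vᴴ V = P Q P - (P Q)³ P = 0`. -/
theorem comm_of_projection_power {P Q : E →L[𝕜] E} (hP : Pᴴ = P) (hQ : Qᴴ = Q)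
    (hPP : P ∘L P = P) (hQQ : Q ∘L Q = Q)
    (h : P ∘L Q ∘L P ∘L Q ∘L P ∘L Q = P ∘L Q) : P ∘L Q = Q ∘L P := by
  have hPP' : ∀ S : E →L[𝕜] E, P ∘L P ∘L S = P ∘L S := fun S => by rw [← comp_assoc, hPP]
  have hQQ' : ∀ S : E →L[𝕜] E, Q ∘L Q ∘L S = Q ∘L S := fun S => by rw [← comp_assoc, hQQ]
  have hW : Q ∘L P - P ∘L Q ∘L P = 0 := by
    apply eq_zero_of_adjoint_comp_add_eq_zero (V := P ∘L Q ∘L P - Q ∘L P ∘L Q ∘L P)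
    have h' : P ∘L Q ∘L P ∘L Q ∘L P ∘L Q ∘L P = P ∘L Q ∘L P := by
      simpa only [comp_assoc] using congrArg (· ∘L P) h
    simp only [map_sub, adjoint_comp, hP, hQ, comp_sub, sub_comp, comp_assoc, hPP', hQQ',
      h']
    abel
  rw [sub_eq_zero] at hW
  have := congrArg adjoint hW
  simp only [adjoint_comp, hP, hQ, comp_assoc] at this
  rw [this, ← hW]

/-! ### Commutation with Gram operators and Greville's theorem -/

theorem adjoint_pow (T : E →L[𝕜] E) (n : ℕ) : (T ^ n)ᴴ = Tᴴ ^ n := star_pow T n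

/-- The operator `Q` commutes with the Gram operator `Aᴴ A` of `A`. -/
def CommGram (A : E →L[𝕜] F) (Q : E →L[𝕜] E) : Prop :=
  Aᴴ ∘L A ∘L Q = Q ∘L Aᴴ ∘L A

section

variable {A : E →L[𝕜] F} {X : F →L[𝕜] E} {Q : E →L[𝕜] E}

theorem CommGram.adjoint_comp_comp (h : CommGram A Q) (hX : IsMoorePenrose A X) (hQ : Qᴴ = Q) :
    (A ∘L Q ∘L X)ᴴ = A ∘L Q ∘L X := by
  have h1 := congrArg (fun T => Xᴴ ∘L T ∘L X) h
  simp only [comp_assoc, hX.adj_x_adj_a_assoc, hX.axa_assoc, hX.a'ax] at h1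
  simp only [adjoint_comp, hQ, comp_assoc]
  exact h1.symm

theorem CommGram.comm_proj (h : CommGram A Q) (hX : IsMoorePenrose A X) (hQ : Qᴴ = Q) :
    X ∘L A ∘L Q = Q ∘L X ∘L A := by
  have h1 := h.adjoint_comp_comp hX hQ
  simp only [adjoint_comp, hQ, comp_assoc] at h1
  have h2 : X ∘L A ∘L Q ∘L Aᴴ = Q ∘L Aᴴ := by
    have h3 := congrArg (fun T => Aᴴ ∘L T) h1
    have h4 := congrArg (fun T => T ∘L X) h
    simp only [comp_assoc, hX.adj_a_adj_x_assoc, hX.a'ax] at h3 h4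
    rw [h3, h4]
  have h5 := congrArg (fun T => T ∘L Xᴴ) h2
  simp only [comp_assoc, hX.adj_a_adj_x] at h5
  have h6 := congrArg adjoint h5
  simp only [adjoint_comp, hX.adj_a_adj_x, hQ, comp_assoc] at h6
  rw [← h5, h6]

/-- Since `Xᴴ` has Gram operator `X Xᴴ = (Aᴴ A)†`, commutation with the Gram operator passes from
`A` to `Xᴴ`. -/
theorem CommGram.adjoint_inv (h : CommGram A Q) (hX : IsMoorePenrose A X) (hQ : Qᴴ = Q) :
    CommGram Xᴴ Q := by
  have hc := h.comm_proj hX hQ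
  have h1 := congrArg (fun T => X ∘L Xᴴ ∘L T ∘L X ∘L Xᴴ) h
  have hc2 := congrArg (fun T => T ∘L X ∘L Xᴴ) hc
  have hc3 := congrArg (fun T => X ∘L Xᴴ ∘L T) hc
  simp only [comp_assoc, hX.adj_x_adj_a_assoc, hX.xax_assoc, hX.axa_assoc, hX.a'ax_assoc,
    hX.adj_a_adj_x, hX.x'xa_assoc] at h1 hc2 hc3
  simp only [CommGram, adjoint_adjoint]
  rw [← hc2, h1, ← hc3]

variable {B : G →L[𝕜] E} {Y : E →L[𝕜] G}

/-- Greville's condition is sufficient for the reverse order law. -/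
theorem isMoorePenrose_comp (hX : IsMoorePenrose A X) (hY : IsMoorePenrose B Y)
    (h1 : CommGram A (B ∘L Y)) (h2 : CommGram Bᴴ (X ∘L A)) :
    IsMoorePenrose (A ∘L B) (Y ∘L X) := by
  have c1 := h1.comm_proj hX hY.2.2.1
  have a1 := h1.adjoint_comp_comp hX hY.2.2.1
  have a2 := h2.adjoint_comp_comp hY.adjoint hX.2.2.2
  simp only [adjoint_comp, adjoint_adjoint, hX.adj_a_adj_x, comp_assoc] at a2
  simp only [comp_assoc] at c1 a1
  have c2 := congrArg (fun T => A ∘L T ∘L B) c1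
  have c3 := congrArg (fun T => Y ∘L T ∘L X) c1
  simp only [comp_assoc, hX.axa_assoc, hY.axa, hY.xax_assoc, hX.xax] at c2 c3
  refine ⟨?_, ?_, ?_, ?_⟩
  · simp only [Penrose1, comp_assoc]; exact c2.symm
  · simp only [Penrose2, comp_assoc]; exact c3
  · simp only [Penrose3, comp_assoc]; exact a1
  · simp only [Penrose4, comp_assoc, adjoint_comp, hX.adj_a_adj_x_assoc]; exact a2.symm

/-- Half of the necessity of Greville's condition. With `P = X A`, the first and fourth Penrose
equations give `Y X (A B) (A B)ᴴ = (A B)ᴴ`, from which `W = (1 - P) B Bᴴ Aᴴ` satisfies `Wᴴ W = 0`.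
Thus `B Bᴴ` leaves the range of `P` invariant, and being self-adjoint it commutes with `P`. -/
theorem commGram_adjoint_of_penrose (hX : IsMoorePenrose A X) (hY : IsMoorePenrose B Y)
    (h1 : Penrose1 (A ∘L B) (Y ∘L X)) (h4 : Penrose4 (A ∘L B) (Y ∘L X)) :
    CommGram Bᴴ (X ∘L A) := by
  have h : Y ∘L X ∘L A ∘L B ∘L Bᴴ ∘L Aᴴ = Bᴴ ∘L Aᴴ := by
    have e1 : ((A ∘L B) ∘L ((Y ∘L X) ∘L A ∘L B))ᴴ = (A ∘L B)ᴴ := congrArg adjoint h1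
    rw [adjoint_comp (A ∘L B), show ((Y ∘L X) ∘L A ∘L B)ᴴ = _ from h4] at e1
    simpa only [adjoint_comp, comp_assoc] using e1
  have hW : B ∘L Bᴴ ∘L Aᴴ - X ∘L A ∘L B ∘L Bᴴ ∘L Aᴴ = 0 := by
    apply eq_zero_of_adjoint_comp_eq_zero
    have e2 := congrArg (fun T => A ∘L B ∘L Bᴴ ∘L B ∘L T) h
    simp only [hY.a'ax_assoc] at e2
    simp only [map_sub, adjoint_comp, adjoint_adjoint, comp_sub, sub_comp, comp_assoc,
      hX.adj_a_adj_x_assoc, hX.axa_assoc, e2]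
    abel
  rw [sub_eq_zero] at hW
  have e3 := congrArg (fun T => T ∘L Xᴴ) hW
  simp only [comp_assoc, hX.adj_a_adj_x] at e3
  have e4 := congrArg adjoint e3
  simp only [adjoint_comp, adjoint_adjoint, comp_assoc, hX.adj_a_adj_x] at e4
  simp only [CommGram, adjoint_adjoint, comp_assoc]
  rw [e3, e4]

/-- The other half of the necessity of Greville's condition, by passing to adjoints. -/
theorem commGram_of_penrose (hX : IsMoorePenrose A X) (hY : IsMoorePenrose B Y)
    (h1 : Penrose1 (A ∘L B) (Y ∘L X)) (h3 : Penrose3 (A ∘L B) (Y ∘L X)) :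
    CommGram A (B ∘L Y) := by
  have := commGram_adjoint_of_penrose hY.adjoint hX.adjoint
    (by
      have := congrArg adjoint h1
      simpa only [Penrose1, adjoint_comp, comp_assoc] using this)
    (by
      rw [Penrose4, ← adjoint_comp, ← adjoint_comp, ← adjoint_comp, adjoint_adjoint]
      exact h3.symm)
  rwa [adjoint_adjoint, hY.adj_x_adj_a] at this

end

/-- Greville's condition for the reverse order law `(A B)† = B† A†`: the Gram operator `Aᴴ A`
commutes with the projection `B B†` onto the range of `B`, and `B Bᴴ` commutes with the projection
`A† A` onto the orthogonal complement of the kernel of `A`. -/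
def GrevilleCondition (A : F →L[𝕜] G) (B : E →L[𝕜] F) : Prop :=
  CommGram A (B ∘L B†) ∧ CommGram Bᴴ (A† ∘L A)

/-! ### Companions -/

/-! Most operators in the theorem arise by replacing the left factor `A` by an operator with the same
initial projection and with at least the same commutation properties, and the right factor `B`
dually. -/

/-- `A'`, with Moore-Penrose inverse `X'`, can replace `A` as a left factor: it has the same kernel,
expressed by `X' A' = A† A`, and every self-adjoint operator that commutes with the Gram operator of
`A` commutes with that of `A'`. -/
structure Companion (A : E →L[𝕜] F) (A' : E →L[𝕜] G) (X' : G →L[𝕜] E) : Prop where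
  isMoorePenrose : IsMoorePenrose A' X'
  proj : X' ∘L A' = A† ∘L A
  commGram : ∀ Q : E →L[𝕜] E, Qᴴ = Q → CommGram A Q → CommGram A' Q

/-- `B'`, with Moore-Penrose inverse `Y'`, can replace `B` as a right factor: the notion dual to
`Companion`, with the final projection `B B†` and the operator `B Bᴴ`. -/
def Cocompanion (B : E →L[𝕜] F) (B' : G →L[𝕜] F) (Y' : F →L[𝕜] G) : Prop :=
  Companion Bᴴ B'ᴴ Y'ᴴ

theorem CommGram.selfAdjoint_pow {T Q : E →L[𝕜] E} (hT : Tᴴ = T) (h : T ∘L Q = Q ∘L T) (k : ℕ) :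
    CommGram (T ^ k) Q := by
  have hk : (T ^ k)ᴴ = T ^ k := by
    have : IsSelfAdjoint T := hT
    exact this.pow k
  have hc : Commute (T ^ k) Q := (show Commute T Q from h).pow_left k
  rw [CommGram, hk]
  exact (hc.mul_left hc).eq.trans rfl

namespace Companion

variable {A : E →L[𝕜] F}

theorem self (hA : HasMoorePenrose A) : Companion A A A† :=
  ⟨mpInv_spec hA, rfl, fun _ _ h => h⟩

theorem projection (hA : HasMoorePenrose A) : Companion A (A† ∘L A) (A† ∘L A) := by
  have h := mpInv_spec hA
  refine ⟨⟨?_, ?_, ?_, ?_⟩, ?_, fun Q hQ hc => ?_⟩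
  iterate 2
    simp only [Penrose1, Penrose2, comp_assoc, h.xax_assoc]
  iterate 2
    simp only [Penrose3, Penrose4, comp_assoc, h.xax_assoc, adjoint_comp, h.adj_a_adj_x]
  · simp only [comp_assoc, h.xax_assoc]
  · simp only [CommGram, comp_assoc, adjoint_comp, h.adj_a_adj_x, h.xax_assoc]
    exact hc.comm_proj h hQ

theorem adjoint_mpInv (hA : HasMoorePenrose A) : Companion A A†ᴴ Aᴴ :=
  have h := mpInv_spec hA
  ⟨h.adjoint.symm, h.adj_a_adj_x, fun _ hQ hc => hc.adjoint_inv h hQ⟩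

theorem gram (hA : HasMoorePenrose A) : Companion A (Aᴴ ∘L A) (A† ∘L A†ᴴ) := by
  have h := mpInv_spec hA
  refine ⟨⟨?_, ?_, ?_, ?_⟩, ?_, fun Q hQ hc => ?_⟩
  · simp only [Penrose1, comp_assoc, h.adj_x_adj_a_assoc, h.axa_assoc, h.a'ax_assoc]
  · simp only [Penrose2, comp_assoc, h.adj_x_adj_a_assoc, h.axx']
  iterate 2
    simp only [Penrose3, Penrose4, comp_assoc, h.axx', h.adj_a_adj_x,
      h.adj_x_adj_a_assoc, h.axa, adjoint_comp]
  · simp only [comp_assoc, h.adj_x_adj_a_assoc, h.axa]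
  · simpa using CommGram.selfAdjoint_pow (T := Aᴴ ∘L A) (Q := Q)
      (by simp only [adjoint_comp, adjoint_adjoint]) hc 1

theorem gram_pow (hA : HasMoorePenrose A) (m : ℕ) :
    Companion A (((Aᴴ ∘L A) ^ (m + 1))) (((A† ∘L A†ᴴ) ^ (m + 1))) := by
  have h := mpInv_spec hA
  have g := gram hA
  have key : IsMoorePenrose (((Aᴴ ∘L A) ^ (m + 1))) (((A† ∘L A†ᴴ) ^ (m + 1))) ∧
      ((Aᴴ ∘L A) ^ (m + 1)) ∘L ((A† ∘L A†ᴴ) ^ (m + 1)) = A† ∘L A ∧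
      ((A† ∘L A†ᴴ) ^ (m + 1)) ∘L ((Aᴴ ∘L A) ^ (m + 1)) = A† ∘L A := by
    induction m with
    | zero =>
      simp only [zero_add, pow_one]
      exact ⟨g.1, by simp only [comp_assoc, h.axx', h.adj_a_adj_x], g.2⟩
    | succ m ih =>
      obtain ⟨i1, i2, i3⟩ := ih
      rw [pow_succ' (Aᴴ ∘L A), pow_succ (A† ∘L A†ᴴ)]
      simp only [mul_def]
      generalize ((Aᴴ ∘L A) ^ (m + 1)) = C at *
      generalize ((A† ∘L A†ᴴ) ^ (m + 1)) = Z at *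
      have i2' : ∀ S : E →L[𝕜] E, C ∘L Z ∘L S = A† ∘L A ∘L S := fun S => by
        rw [← comp_assoc, i2, comp_assoc]
      have j : A† ∘L A ∘L C = C := by rw [← comp_assoc, ← i2, comp_assoc, i1.axa]
      have j' : Z ∘L A† ∘L A = Z := by rw [← i2, i1.xax]
      have e1 : ((Aᴴ ∘L A) ∘L C) ∘L (Z ∘L A† ∘L A†ᴴ) = A† ∘L A := by
        simp only [comp_assoc, i2', h.axx', h.adj_a_adj_x]
      have e2 : (Z ∘L A† ∘L A†ᴴ) ∘L ((Aᴴ ∘L A) ∘L C) = A† ∘L A := by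
        simp only [comp_assoc, h.adj_x_adj_a_assoc, j, i3]
      refine ⟨⟨?_, ?_, ?_, ?_⟩, e1, e2⟩
      · rw [Penrose1, e2]; rw [comp_assoc, ← i3, i1.axa]
      · rw [Penrose2, e1, comp_assoc, comp_assoc, h.x'xa]
      · rw [Penrose3, e1]; exact h.2.2.2
      · rw [Penrose4, e2]; exact h.2.2.2
  exact ⟨key.1, key.2.2, fun Q hQ hc => CommGram.selfAdjoint_pow
    (T := Aᴴ ∘L A) (by simp only [adjoint_comp, adjoint_adjoint]) hc _⟩

theorem pow_comp_eq (A : E →L[𝕜] F) (m : ℕ) : ((A ∘L Aᴴ) ^ m) ∘L A = A ∘L ((Aᴴ ∘L A) ^ m) := by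
  induction m with
  | zero => rfl
  | succ m ih =>
    rw [pow_succ', pow_succ', mul_def, mul_def, comp_assoc, ih]
    simp only [comp_assoc]

theorem pow_comp (hA : HasMoorePenrose A) (m : ℕ) :
    Companion A (((A ∘L Aᴴ) ^ m) ∘L A) (A† ∘L ((A†ᴴ ∘L A†) ^ m)) := by
  have h := mpInv_spec hA
  have key : IsMoorePenrose (((A ∘L Aᴴ) ^ m) ∘L A) (A† ∘L ((A†ᴴ ∘L A†) ^ m)) ∧
      (((A ∘L Aᴴ) ^ m) ∘L A) ∘L (A† ∘L ((A†ᴴ ∘L A†) ^ m)) = A ∘L A† ∧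
      (A† ∘L ((A†ᴴ ∘L A†) ^ m)) ∘L (((A ∘L Aᴴ) ^ m) ∘L A) = A† ∘L A := by
    induction m with
    | zero => exact ⟨h, rfl, rfl⟩
    | succ m ih =>
      obtain ⟨i1, i2, i3⟩ := ih
      rw [pow_succ' (A ∘L Aᴴ), pow_succ (A†ᴴ ∘L A†)]
      simp only [mul_def]
      rw [comp_assoc _ _ A, ← comp_assoc A†]
      generalize ((A ∘L Aᴴ) ^ m) ∘L A = C at *
      generalize A† ∘L ((A†ᴴ ∘L A†) ^ m) = Z at *
      have i2' : ∀ S : F →L[𝕜] F, C ∘L Z ∘L S = A ∘L A† ∘L S := fun S => by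
        rw [← comp_assoc, i2, comp_assoc]
      have j : A ∘L A† ∘L C = C := by rw [← comp_assoc, ← i2, comp_assoc, i1.axa]
      have e1 : ((A ∘L Aᴴ) ∘L C) ∘L (Z ∘L A†ᴴ ∘L A†) = A ∘L A† := by
        simp only [comp_assoc, i2', h.axx'_assoc, h.adj_a_adj_x_assoc, h.xax]
      have e2 : (Z ∘L A†ᴴ ∘L A†) ∘L ((A ∘L Aᴴ) ∘L C) = A† ∘L A := by
        simp only [comp_assoc, h.xaa'_assoc, h.adj_x_adj_a_assoc, j, i3]
      refine ⟨⟨?_, ?_, ?_, ?_⟩, e1, e2⟩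
      · rw [Penrose1, e2]; rw [comp_assoc, ← i3, i1.axa]
      · rw [Penrose2, e1, comp_assoc, comp_assoc, h.xax]
      · rw [Penrose3, e1]; exact h.2.2.1
      · rw [Penrose4, e2]; exact h.2.2.2
  refine ⟨key.1, key.2.2, fun Q hQ hc => ?_⟩
  have hs : IsSelfAdjoint (Aᴴ ∘L A) := by
    change (Aᴴ ∘L A)ᴴ = _
    simp only [adjoint_comp, adjoint_adjoint]
  have hcm : Commute (Aᴴ ∘L A) Q := hc
  have hs' : (((Aᴴ ∘L A) ^ m))ᴴ = ((Aᴴ ∘L A) ^ m) := hs.pow m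
  have : Commute (((Aᴴ ∘L A) ^ m) * (Aᴴ ∘L A) * ((Aᴴ ∘L A) ^ m)) Q :=
    ((hcm.pow_left m).mul_left hcm).mul_left (hcm.pow_left m)
  have := this.eq
  simp only [mul_def, comp_assoc] at this
  rw [pow_comp_eq]
  simp only [CommGram, adjoint_comp, hs', comp_assoc]
  exact this

end Companion

theorem Companion.adjoint {B : E →L[𝕜] F} {B' : F →L[𝕜] G} {Y' : G →L[𝕜] F}
    (h : Companion Bᴴ B' Y') : Cocompanion B B'ᴴ Y'ᴴ := by
  simpa only [Cocompanion, adjoint_adjoint] using h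

namespace Cocompanion

variable {B : E →L[𝕜] F} {B' : G →L[𝕜] F} {Y' : F →L[𝕜] G}

theorem isMoorePenrose (h : Cocompanion B B' Y') : IsMoorePenrose B' Y' := by
  simpa only [adjoint_adjoint] using (Companion.isMoorePenrose h).adjoint

theorem proj (hB : HasMoorePenrose B) (h : Cocompanion B B' Y') : B' ∘L Y' = B ∘L B† := by
  have := Companion.proj h
  rwa [hB.mpInv_adjoint, (mpInv_spec hB).adj_x_adj_a, h.isMoorePenrose.adj_x_adj_a] at this

theorem self (hB : HasMoorePenrose B) : Cocompanion B B B† := by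
  simpa only [hB.mpInv_adjoint, adjoint_adjoint] using (Companion.self hB.adjoint).adjoint

theorem projection (hB : HasMoorePenrose B) : Cocompanion B (B ∘L B†) (B ∘L B†) := by
  simpa only [hB.mpInv_adjoint, adjoint_adjoint, adjoint_comp] using
    (Companion.projection hB.adjoint).adjoint

theorem adjoint_mpInv (hB : HasMoorePenrose B) : Cocompanion B B†ᴴ Bᴴ := by
  simpa only [hB.mpInv_adjoint, adjoint_adjoint] using
    (Companion.adjoint_mpInv hB.adjoint).adjoint

theorem gram (hB : HasMoorePenrose B) : Cocompanion B (B ∘L Bᴴ) (B†ᴴ ∘L B†) := by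
  simpa only [hB.mpInv_adjoint, adjoint_adjoint, adjoint_comp] using
    (Companion.gram hB.adjoint).adjoint

theorem gram_pow (hB : HasMoorePenrose B) (n : ℕ) :
    Cocompanion B ((B ∘L Bᴴ) ^ (n + 1)) ((B†ᴴ ∘L B†) ^ (n + 1)) := by
  simpa only [hB.mpInv_adjoint, adjoint_adjoint, adjoint_comp, adjoint_pow] using
    (Companion.gram_pow hB.adjoint n).adjoint

theorem comp_pow (hB : HasMoorePenrose B) (n : ℕ) :
    Cocompanion B (B ∘L ((Bᴴ ∘L B) ^ n)) (((B† ∘L B†ᴴ) ^ n) ∘L B†) := by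
  simpa only [hB.mpInv_adjoint, adjoint_adjoint, adjoint_comp, adjoint_pow] using
    (Companion.pow_comp hB.adjoint n).adjoint

end Cocompanion

/-! ### Products of companions -/

section

variable {E' G' : Type*}
  [NormedAddCommGroup E'] [InnerProductSpace 𝕜 E'] [CompleteSpace E']
  [NormedAddCommGroup G'] [InnerProductSpace 𝕜 G'] [CompleteSpace G']
  {A : F →L[𝕜] G} {B : E →L[𝕜] F} {A' : F →L[𝕜] G'} {X' : G' →L[𝕜] F}
  {B' : E' →L[𝕜] F} {Y' : F →L[𝕜] E'}

/-- If `A B` has a Moore-Penrose inverse, so has `A' B'`. Indeed `A' B' = U (A B) V` with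
`U = A' A†` and `V = B† B'`, where `A X'` undoes `U` and `Y' B` undoes `V`, so
`Y' B (A B)† A X'` is an inner inverse. -/
theorem Companion.hasMoorePenrose_comp (hA : HasMoorePenrose A) (hB : HasMoorePenrose B)
    (hAB : HasMoorePenrose (A ∘L B)) (cA : Companion A A' X') (cB : Cocompanion B B' Y') :
    HasMoorePenrose (A' ∘L B') := by
  have h := mpInv_spec hA
  have k := mpInv_spec hB
  have hZ := (mpInv_spec hAB).axa
  have pA := cA.proj
  have pB := cB.proj hB
  have hA' : A' ∘L A† ∘L A = A' := by rw [← pA, cA.isMoorePenrose.axa]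
  have hB' : B ∘L B† ∘L B' = B' := by rw [← comp_assoc, ← pB, comp_assoc, cB.isMoorePenrose.axa]
  apply hasMoorePenrose_of_penrose1 (X := (Y' ∘L B) ∘L (A ∘L B)† ∘L (A ∘L X'))
  have pA' : ∀ S : E' →L[𝕜] F, X' ∘L A' ∘L S = A† ∘L A ∘L S := fun S => by
    rw [← comp_assoc, pA, comp_assoc]
  have pB' : ∀ S : E' →L[𝕜] F, B' ∘L Y' ∘L S = B ∘L B† ∘L S := fun S => by
    rw [← comp_assoc, pB, comp_assoc]
  have hZ' := congrArg (fun T => (A' ∘L A†) ∘L T ∘L (B† ∘L B')) hZ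
  simp only [comp_assoc, hB'] at hZ'
  simp only [Penrose1, comp_assoc, pA', pB', h.axa_assoc, k.axa_assoc]
  have e : A' ∘L A† ∘L A ∘L B' = A' ∘L B' := by
    conv_rhs => rw [← hA']
    simp only [comp_assoc]
  have e' : ∀ S : E' →L[𝕜] E, A' ∘L A† ∘L A ∘L B ∘L S = A' ∘L B ∘L S := fun S => by
    conv_rhs => rw [← hA']
    simp only [comp_assoc]
  rw [e, e'] at hZ'
  exact hZ'

theorem GrevilleCondition.companion (hA : HasMoorePenrose A) (hB : HasMoorePenrose B)
    (hG : GrevilleCondition A B) (cA : Companion A A' X') (cB : Cocompanion B B' Y') :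
    GrevilleCondition A' B' := by
  rw [GrevilleCondition, cA.isMoorePenrose.mpInv_eq, cB.isMoorePenrose.mpInv_eq, cA.proj,
    cB.proj hB]
  exact ⟨cA.commGram _ (mpInv_spec hB).2.2.1 hG.1,
    Companion.commGram cB _ (mpInv_spec hA).2.2.2 hG.2⟩

theorem GrevilleCondition.mpInv_comp (hA : HasMoorePenrose A) (hB : HasMoorePenrose B)
    (hG : GrevilleCondition A B) (cA : Companion A A' X') (cB : Cocompanion B B' Y') :
    (A' ∘L B')† = Y' ∘L X' := by
  have := hG.companion hA hB cA cB
  rw [GrevilleCondition, cA.isMoorePenrose.mpInv_eq, cB.isMoorePenrose.mpInv_eq] at this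
  exact (isMoorePenrose_comp cA.isMoorePenrose cB.isMoorePenrose this.1 this.2).mpInv_eq

end

theorem grevilleCondition_adjoint_mpInv_left_iff {A : F →L[𝕜] G} {B : E →L[𝕜] F}
    (hA : HasMoorePenrose A) (hB : HasMoorePenrose B) :
    GrevilleCondition A†ᴴ B ↔ GrevilleCondition A B := by
  have h := mpInv_spec hA
  have h' : HasMoorePenrose A†ᴴ := h.symm.adjoint.hasMP
  have e : A†ᴴ† = Aᴴ := h.symm.adjoint.mpInv_eq
  refine ⟨fun hG => ?_, fun hG => hG.companion hA hB (.adjoint_mpInv hA) (.self hB)⟩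
  simpa only [e, adjoint_adjoint] using hG.companion h' hB (.adjoint_mpInv h') (.self hB)

theorem grevilleCondition_adjoint_mpInv_right_iff {A : F →L[𝕜] G} {B : E →L[𝕜] F}
    (hA : HasMoorePenrose A) (hB : HasMoorePenrose B) :
    GrevilleCondition A B†ᴴ ↔ GrevilleCondition A B := by
  have h := mpInv_spec hB
  have h' : HasMoorePenrose B†ᴴ := h.symm.adjoint.hasMP
  have e : B†ᴴ† = Bᴴ := h.symm.adjoint.mpInv_eq
  refine ⟨fun hG => ?_, fun hG => hG.companion hA hB (.self hA) (.adjoint_mpInv hB)⟩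
  simpa only [e, adjoint_adjoint] using hG.companion hA h' (.self hA) (.adjoint_mpInv h')

/-! ### Reformulations of the reverse order law -/

section

variable {A : F →L[𝕜] G} {B : E →L[𝕜] F} {X : G →L[𝕜] F} {Y : F →L[𝕜] E}

theorem grevilleCondition_of_mem_inverses134 (hX : IsMoorePenrose A X) (hY : IsMoorePenrose B Y)
    (h : Y ∘L X ∈ inverses134 (A ∘L B)) : GrevilleCondition A B := by
  rw [GrevilleCondition, hX.mpInv_eq, hY.mpInv_eq]
  exact ⟨commGram_of_penrose hX hY h.1 h.2.1, commGram_adjoint_of_penrose hX hY h.1 h.2.2⟩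

theorem comp_comp_mpInv_comp (hY : IsMoorePenrose B Y) (hAB : HasMoorePenrose (A ∘L B)) :
    Y ∘L B ∘L (A ∘L B)† = (A ∘L B)† := by
  have hZ := mpInv_spec hAB
  have e : (A ∘L B)ᴴ ∘L (A ∘L B)†ᴴ ∘L (A ∘L B)† = (A ∘L B)† := by
    rw [hZ.adj_a_adj_x_assoc, hZ.xax]
  rw [← e, adjoint_comp]
  simp only [comp_assoc, hY.xaa'_assoc]

theorem mpInv_comp_comp_comp (hX : IsMoorePenrose A X) (hAB : HasMoorePenrose (A ∘L B)) :
    (A ∘L B)† ∘L A ∘L X = (A ∘L B)† := by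
  have hZ := mpInv_spec hAB
  have e : (A ∘L B)† ∘L (A ∘L B)†ᴴ ∘L (A ∘L B)ᴴ = (A ∘L B)† := by
    rw [hZ.adj_x_adj_a, hZ.xax]
  rw [← e, adjoint_comp]
  simp only [comp_assoc, hX.a'ax]

theorem mpInv_comp_iff (hX : IsMoorePenrose A X) (hY : IsMoorePenrose B Y)
    (hAB : HasMoorePenrose (A ∘L B)) : (A ∘L B)† = Y ∘L X ↔ GrevilleCondition A B := by
  refine ⟨fun h => ?_, fun hG => ?_⟩
  · have hZ := mpInv_spec hAB
    rw [h] at hZ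
    exact grevilleCondition_of_mem_inverses134 hX hY ⟨hZ.1, hZ.2.2⟩
  · have := hG.mpInv_comp hX.hasMP hY.hasMP (.self hX.hasMP) (.self hY.hasMP)
    rwa [hX.mpInv_eq, hY.mpInv_eq] at this

theorem comp_mpInv_comp_iff (hX : IsMoorePenrose A X) (hY : IsMoorePenrose B Y)
    (hAB : HasMoorePenrose (A ∘L B)) :
    B ∘L (A ∘L B)† ∘L A = B ∘L Y ∘L X ∘L A ↔ GrevilleCondition A B := by
  rw [← mpInv_comp_iff hX hY hAB]
  refine ⟨fun h => ?_, fun h => by rw [h]; rfl⟩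
  have h' := congrArg (fun T => Y ∘L T ∘L X) h
  simpa only [comp_assoc, comp_comp_mpInv_comp hY hAB, mpInv_comp_comp_comp hX hAB, hY.xax_assoc,
    hX.xax] using h'

theorem gram_comp_mpInv_comp_gram_iff (hX : IsMoorePenrose A X) (hY : IsMoorePenrose B Y)
    (hAB : HasMoorePenrose (A ∘L B)) :
    A ∘L Aᴴ ∘L (Bᴴ ∘L Aᴴ)† ∘L Bᴴ ∘L B = A ∘L B ↔ GrevilleCondition A B := by
  rw [← mpInv_comp_iff hX hY hAB, ← adjoint_comp, hAB.mpInv_adjoint]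
  refine ⟨fun h => ?_, fun h => ?_⟩
  · have h' := congrArg (fun T => Y ∘L Yᴴ ∘L Tᴴ ∘L Xᴴ ∘L X) h
    simp only [adjoint_comp, adjoint_adjoint, comp_assoc, hX.adj_a_adj_x_assoc, hX.xax,
      hY.adj_x_adj_a_assoc, hY.xax_assoc, comp_comp_mpInv_comp hY hAB,
      mpInv_comp_comp_comp hX hAB] at h'
    exact h'
  · rw [h]
    simp only [adjoint_comp, comp_assoc, hX.adj_a_adj_x_assoc, hX.axa_assoc,
      hY.adj_x_adj_a_assoc, hY.axa]

/-- Inserting the formula for `(A B)†` into `A B (A B)† A B = A B` and multiplying by `X` and `Y`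
gives `(P Q)³ = P Q` for `P = X A` and `Q = B Y`, so that `P` and `Q` commute and the formula
collapses to `Y X`. -/
theorem mpInv_comp_eq_sandwich_iff (hX : IsMoorePenrose A X) (hY : IsMoorePenrose B Y)
    (hAB : HasMoorePenrose (A ∘L B)) :
    (A ∘L B)† = Y ∘L X ∘L A ∘L B ∘L Y ∘L X ↔ GrevilleCondition A B := by
  rw [← mpInv_comp_iff hX hY hAB]
  have hZ := mpInv_spec hAB
  refine ⟨fun h => ?_, fun h => ?_⟩
  · have h1 := hZ.axa
    rw [h] at h1
    have h2 := congrArg (fun T => X ∘L T ∘L Y) h1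
    simp only [comp_assoc] at h2
    have hc : (X ∘L A) ∘L (B ∘L Y) = (B ∘L Y) ∘L (X ∘L A) :=
      comm_of_projection_power hX.2.2.2 hY.2.2.1 (by rw [comp_assoc, hX.axa])
        (by rw [comp_assoc, hY.xax]) (by simpa only [comp_assoc] using h2)
    have h3 := congrArg (fun T => Y ∘L T ∘L X) hc
    simp only [comp_assoc, hY.xax_assoc, hX.xax] at h3
    rw [h, h3]
  · have h1 := hZ.xax
    rw [h] at h1 ⊢
    simpa only [comp_assoc] using h1.symm

theorem mpInv_comp_eq_left_projection_iff (hX : IsMoorePenrose A X) (hY : IsMoorePenrose B Y)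
    (hAB : HasMoorePenrose (A ∘L B)) :
    ((A ∘L B)† = (X ∘L A ∘L B)† ∘L X ∧ (X ∘L A ∘L B)† = Y ∘L X ∘L A) ↔
      GrevilleCondition A B := by
  refine ⟨fun h => ?_, fun hG => ?_⟩
  · rw [← mpInv_comp_iff hX hY hAB, h.1, h.2]
    simp only [comp_assoc, hX.xax]
  · have h1 := (mpInv_comp_iff hX hY hAB).2 hG
    have h2 := hG.mpInv_comp hX.hasMP hY.hasMP (.projection hX.hasMP) (.self hY.hasMP)
    rw [hX.mpInv_eq, hY.mpInv_eq, comp_assoc] at h2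
    rw [h1, h2]
    simp only [comp_assoc, hX.xax, and_self]

theorem mpInv_comp_eq_right_projection_iff (hX : IsMoorePenrose A X) (hY : IsMoorePenrose B Y)
    (hAB : HasMoorePenrose (A ∘L B)) :
    ((A ∘L B)† = Y ∘L (A ∘L B ∘L Y)† ∧ (A ∘L B ∘L Y)† = B ∘L Y ∘L X) ↔
      GrevilleCondition A B := by
  refine ⟨fun h => ?_, fun hG => ?_⟩
  · rw [← mpInv_comp_iff hX hY hAB, h.1, h.2]
    simp only [hY.xax_assoc]
  · have h1 := (mpInv_comp_iff hX hY hAB).2 hG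
    have h2 := hG.mpInv_comp hX.hasMP hY.hasMP (.self hX.hasMP) (.projection hY.hasMP)
    rw [hX.mpInv_eq, hY.mpInv_eq] at h2
    rw [h1, h2]
    simp only [comp_assoc, hY.xax_assoc, and_self]

theorem mpInv_comp_eq_projections_iff (hX : IsMoorePenrose A X) (hY : IsMoorePenrose B Y)
    (hAB : HasMoorePenrose (A ∘L B)) :
    ((A ∘L B)† = Y ∘L (X ∘L A ∘L B ∘L Y)† ∘L X ∧ (X ∘L A ∘L B ∘L Y)† = B ∘L Y ∘L X ∘L A) ↔
      GrevilleCondition A B := by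
  refine ⟨fun h => ?_, fun hG => ?_⟩
  · rw [← mpInv_comp_iff hX hY hAB, h.1, h.2]
    simp only [comp_assoc, hY.xax_assoc, hX.xax]
  · have h1 := (mpInv_comp_iff hX hY hAB).2 hG
    have h2 := hG.mpInv_comp hX.hasMP hY.hasMP (.projection hX.hasMP) (.projection hY.hasMP)
    rw [hX.mpInv_eq, hY.mpInv_eq, comp_assoc] at h2
    rw [h1, h2]
    simp only [comp_assoc, hY.xax_assoc, hX.xax, and_self]

theorem mem_inverses134_iff (hX : IsMoorePenrose A X) (hY : IsMoorePenrose B Y)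
    (hAB : HasMoorePenrose (A ∘L B)) :
    Y ∘L X ∈ inverses134 (A ∘L B) ↔ GrevilleCondition A B := by
  refine ⟨grevilleCondition_of_mem_inverses134 hX hY, fun hG => ?_⟩
  have hZ := mpInv_spec hAB
  rw [(mpInv_comp_iff hX hY hAB).2 hG] at hZ
  exact ⟨hZ.1, hZ.2.2⟩

theorem projections_eq_iff (hX : IsMoorePenrose A X) (hY : IsMoorePenrose B Y)
    (hAB : HasMoorePenrose (A ∘L B)) :
    (((A ∘L B) ∘L (A ∘L B)† = A ∘L B ∘L Y ∘L X ∧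
        A ∘L B ∘L Y ∘L X = Xᴴ ∘L B ∘L Y ∘L Aᴴ) ∧
      ((A ∘L B)† ∘L A ∘L B = Y ∘L X ∘L A ∘L B ∧
        Y ∘L X ∘L A ∘L B = Bᴴ ∘L X ∘L A ∘L Yᴴ)) ↔ GrevilleCondition A B := by
  have hZ := mpInv_spec hAB
  refine ⟨fun ⟨⟨h1, _⟩, h3, _⟩ => ?_, fun hG => ?_⟩
  · apply grevilleCondition_of_mem_inverses134 hX hY
    have h1' : (A ∘L B) ∘L (A ∘L B)† = (A ∘L B) ∘L Y ∘L X := h1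
    have h3' : (A ∘L B)† ∘L A ∘L B = (Y ∘L X) ∘L A ∘L B := h3
    refine ⟨?_, ?_, ?_⟩
    · rw [Penrose1, ← h3', hZ.axa]
    · rw [Penrose3, ← h1']; exact hZ.2.2.1
    · rw [Penrose4, ← h3']; exact hZ.2.2.2
  · have h1 := (mpInv_comp_iff hX hY hAB).2 hG
    have h3 := hZ.adj_x_adj_a
    have h4 := hZ.adj_a_adj_x
    rw [h1] at h3 h4 ⊢
    simp only [adjoint_comp, comp_assoc, hY.adj_x_adj_a_assoc, hX.adj_a_adj_x_assoc] at h3 h4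
    exact ⟨⟨rfl, h3.symm⟩, rfl, h4.symm⟩

end

/-- Passing to adjoints interchanges the third and the fourth Penrose equation. -/
theorem adjoint_mem_inverses134_adjoint_iff {A : E →L[𝕜] F} {X : F →L[𝕜] E} :
    Xᴴ ∈ inverses134 Aᴴ ↔ X ∈ inverses134 A := by
  simp only [inverses134, Set.mem_ofPred_eq, Penrose1, Penrose3, Penrose4, ← adjoint_comp,
    comp_assoc, adjoint_adjoint, EmbeddingLike.apply_eq_iff_eq]
  rw [and_comm (a := X ∘L A = _), eq_comm (b := X ∘L A), eq_comm (b := A ∘L X)]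

/-! ### Cancellation of powers -/

theorem IsMoorePenrose.comp_pow_comp_pow {A : F →L[𝕜] G} {X : G →L[𝕜] F}
    (h : IsMoorePenrose A X) (m : ℕ) : X ∘L ((Xᴴ ∘L X) ^ m) ∘L ((A ∘L Aᴴ) ^ m) = X := by
  induction m with
  | zero => rfl
  | succ m ih =>
    have ih' := congrArg (fun T => X ∘L Xᴴ ∘L T ∘L A ∘L Aᴴ) ih
    simp only [comp_assoc, h.xaa', h.adj_x_adj_a, h.xax] at ih'
    rw [pow_succ', pow_succ (A ∘L Aᴴ)]
    simpa only [mul_def, comp_assoc] using ih'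

theorem IsMoorePenrose.gram_pow_succ_comp_pow {A : F →L[𝕜] G} {X : G →L[𝕜] F}
    (h : IsMoorePenrose A X) (m : ℕ) :
    ((X ∘L Xᴴ) ^ (m + 1)) ∘L ((Aᴴ ∘L A) ^ m) = X ∘L Xᴴ := by
  induction m with
  | zero => rw [zero_add, pow_one, pow_zero]; rfl
  | succ m ih =>
    rw [pow_succ' (X ∘L Xᴴ), pow_succ (Aᴴ ∘L A), mul_def, mul_def, comp_assoc,
      ← comp_assoc _ ((Aᴴ ∘L A) ^ m), ih]
    simp only [comp_assoc, h.adj_x_adj_a_assoc, h.axa, h.x'xa]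

theorem IsMoorePenrose.pow_comp_pow_comp {A : F →L[𝕜] G} {X : G →L[𝕜] F}
    (h : IsMoorePenrose A X) (n : ℕ) : ((Aᴴ ∘L A) ^ n) ∘L ((X ∘L Xᴴ) ^ n) ∘L X = X := by
  have := congrArg adjoint (h.adjoint.comp_pow_comp_pow n)
  simpa only [adjoint_comp, adjoint_pow, adjoint_adjoint, comp_assoc] using this

theorem IsMoorePenrose.pow_comp_gram_pow_succ {A : F →L[𝕜] G} {X : G →L[𝕜] F}
    (h : IsMoorePenrose A X) (n : ℕ) :
    ((A ∘L Aᴴ) ^ n) ∘L ((Xᴴ ∘L X) ^ (n + 1)) = Xᴴ ∘L X := by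
  have := congrArg adjoint (h.adjoint.gram_pow_succ_comp_pow n)
  simpa only [adjoint_comp, adjoint_pow, adjoint_adjoint, comp_assoc] using this

end ReverseOrderLaw

theorem mainTheorem1 {𝕜 H₁ H₂ H₃ : Type*} [RCLike 𝕜]
    [NormedAddCommGroup H₁] [InnerProductSpace 𝕜 H₁] [CompleteSpace H₁]
    [NormedAddCommGroup H₂] [InnerProductSpace 𝕜 H₂] [CompleteSpace H₂]
    [NormedAddCommGroup H₃] [InnerProductSpace 𝕜 H₃] [CompleteSpace H₃]
    (A : H₂ →L[𝕜] H₃) (B : H₁ →L[𝕜] H₂)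
    (hA : IsClosed (Set.range A)) (hB : IsClosed (Set.range B))
    (hAB : IsClosed (Set.range (A ∘L B))) (m n : ℕ) :
    -- all Moore-Penrose inverses that occur below exist
    (HasMoorePenrose A ∧ HasMoorePenrose B ∧ HasMoorePenrose (A ∘L B) ∧
      HasMoorePenrose (Bᴴ ∘L Aᴴ) ∧
      HasMoorePenrose (A† ∘L A ∘L B) ∧ HasMoorePenrose (A ∘L B ∘L B†) ∧
      HasMoorePenrose (A† ∘L A ∘L B ∘L B†) ∧
      HasMoorePenrose (A†ᴴ ∘L B) ∧ HasMoorePenrose (Bᴴ ∘L A†) ∧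
      HasMoorePenrose (A†ᴴ ∘L B ∘L B†) ∧
      HasMoorePenrose (A ∘L B†ᴴ) ∧ HasMoorePenrose (B† ∘L Aᴴ) ∧
      HasMoorePenrose (A† ∘L A ∘L B†ᴴ) ∧
      HasMoorePenrose (B† ∘L A†) ∧
      HasMoorePenrose (B† ∘L A† ∘L A) ∧ HasMoorePenrose (B ∘L B† ∘L A†) ∧
      HasMoorePenrose (B ∘L B† ∘L A† ∘L A) ∧
      HasMoorePenrose (A ∘L Aᴴ) ∧ HasMoorePenrose (Aᴴ ∘L A) ∧
      HasMoorePenrose (B ∘L Bᴴ) ∧ HasMoorePenrose (Bᴴ ∘L B) ∧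
      HasMoorePenrose (Aᴴ ∘L A ∘L B) ∧ HasMoorePenrose (A ∘L B ∘L Bᴴ) ∧
      HasMoorePenrose (Aᴴ ∘L A ∘L B ∘L Bᴴ) ∧
      HasMoorePenrose (((A ∘L Aᴴ) ^ m) ∘L A ∘L B ∘L ((Bᴴ ∘L B) ^ n)) ∧
      HasMoorePenrose (B ∘L ((Bᴴ ∘L B) ^ n)) ∧
      HasMoorePenrose (((A ∘L Aᴴ) ^ m) ∘L A) ∧
      HasMoorePenrose (((Aᴴ ∘L A) ^ (m + 1)) ∘L ((B ∘L Bᴴ) ^ (n + 1)))) ∧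
    List.TFAE (
      -- (1)
      ((A ∘L B)† = B† ∘L A†) ::
      -- (2)
      (B ∘L (A ∘L B)† ∘L A = B ∘L B† ∘L A† ∘L A) ::
      -- (3)
      (A ∘L Aᴴ ∘L (Bᴴ ∘L Aᴴ)† ∘L Bᴴ ∘L B = A ∘L B) ::
      -- (4)
      ((A ∘L B)† = B† ∘L A† ∘L A ∘L B ∘L B† ∘L A†) ::
      -- (5)
      ((A ∘L B)† = (A† ∘L A ∘L B)† ∘L A† ∧ (A† ∘L A ∘L B)† = B† ∘L A† ∘L A) ::
      -- (6)
      ((A ∘L B)† = B† ∘L (A ∘L B ∘L B†)† ∧ (A ∘L B ∘L B†)† = B ∘L B† ∘L A†) ::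
      -- (7)
      ((A ∘L B)† = B† ∘L (A† ∘L A ∘L B ∘L B†)† ∘L A† ∧
        (A† ∘L A ∘L B ∘L B†)† = B ∘L B† ∘L A† ∘L A) ::
      -- (8)
      (B† ∘L A† ∈ inverses134 (A ∘L B)) ::
      -- (9)
      (((A ∘L B) ∘L (A ∘L B)† = A ∘L B ∘L B† ∘L A† ∧
          A ∘L B ∘L B† ∘L A† = A†ᴴ ∘L B ∘L B† ∘L Aᴴ) ∧
        ((A ∘L B)† ∘L A ∘L B = B† ∘L A† ∘L A ∘L B ∧
          B† ∘L A† ∘L A ∘L B = Bᴴ ∘L A† ∘L A ∘L B†ᴴ)) ::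
      -- (10)
      ((A†ᴴ ∘L B)† = B† ∘L Aᴴ) ::
      -- (11)
      (A† ∘L (Bᴴ ∘L A†)† ∘L Bᴴ = A† ∘L A ∘L B ∘L B†) ::
      -- (12)
      (A ∘L A† ∘L (Bᴴ ∘L A†)† ∘L Bᴴ ∘L B = A ∘L B) ::
      -- (13)
      ((A†ᴴ ∘L B)† = B† ∘L A† ∘L A ∘L B ∘L B† ∘L Aᴴ) ::
      -- (14)
      ((A†ᴴ ∘L B)† = (A† ∘L A ∘L B)† ∘L Aᴴ ∧ (A† ∘L A ∘L B)† = B† ∘L A† ∘L A) ::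
      -- (15)
      ((A†ᴴ ∘L B)† = B† ∘L (A†ᴴ ∘L B ∘L B†)† ∧ (A†ᴴ ∘L B ∘L B†)† = B ∘L B† ∘L Aᴴ) ::
      -- (16)
      ((A†ᴴ ∘L B)† = B† ∘L (A† ∘L A ∘L B ∘L B†)† ∘L Aᴴ ∧
        (A† ∘L A ∘L B ∘L B†)† = B ∘L B† ∘L A† ∘L A) ::
      -- (17)
      (B† ∘L Aᴴ ∈ inverses134 (A†ᴴ ∘L B)) ::
      -- (18)
      (((Bᴴ ∘L A†)† ∘L Bᴴ ∘L A† = A ∘L B ∘L B† ∘L A† ∧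
          A ∘L B ∘L B† ∘L A† = A†ᴴ ∘L B ∘L B† ∘L Aᴴ) ∧
        (Bᴴ ∘L A† ∘L (Bᴴ ∘L A†)† = B† ∘L A† ∘L A ∘L B ∧
          B† ∘L A† ∘L A ∘L B = Bᴴ ∘L A† ∘L A ∘L B†ᴴ)) ::
      -- (19)
      ((A ∘L B†ᴴ)† = Bᴴ ∘L A†) ::
      -- (20)
      (B†ᴴ ∘L (A ∘L B†ᴴ)† ∘L A = B ∘L B† ∘L A† ∘L A) ::
      -- (21)
      (A ∘L Aᴴ ∘L (B† ∘L Aᴴ)† ∘L B† ∘L B = A ∘L B) ::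
      -- (22)
      ((A ∘L B†ᴴ)† = Bᴴ ∘L A† ∘L A ∘L B ∘L B† ∘L A†) ::
      -- (23)
      ((A ∘L B†ᴴ)† = (A† ∘L A ∘L B†ᴴ)† ∘L A† ∧ (A† ∘L A ∘L B†ᴴ)† = Bᴴ ∘L A† ∘L A) ::
      -- (24)
      ((A ∘L B†ᴴ)† = Bᴴ ∘L (A ∘L B ∘L B†)† ∧ (A ∘L B ∘L B†)† = B ∘L B† ∘L A†) ::
      -- (25)
      ((A ∘L B†ᴴ)† = Bᴴ ∘L (A† ∘L A ∘L B ∘L B†)† ∘L A† ∧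
        (A† ∘L A ∘L B ∘L B†)† = B ∘L B† ∘L A† ∘L A) ::
      -- (26)
      (Bᴴ ∘L A† ∈ inverses134 (A ∘L B†ᴴ)) ::
      -- (27)
      (((B† ∘L Aᴴ)† ∘L B† ∘L Aᴴ = A ∘L B ∘L B† ∘L A† ∧
          A ∘L B ∘L B† ∘L A† = A†ᴴ ∘L B ∘L B† ∘L Aᴴ) ∧
        (B† ∘L Aᴴ ∘L (B† ∘L Aᴴ)† = B† ∘L A† ∘L A ∘L B ∧
          B† ∘L A† ∘L A ∘L B = Bᴴ ∘L A† ∘L A ∘L B†ᴴ)) ::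
      -- (28)
      ((B† ∘L A†)† = A ∘L B) ::
      -- (29)
      (A† ∘L (B† ∘L A†)† ∘L B† = A† ∘L A ∘L B ∘L B†) ::
      -- (30)
      ((A ∘L Aᴴ)† ∘L (B† ∘L A†)† ∘L (Bᴴ ∘L B)† = A†ᴴ ∘L B†ᴴ) ::
      -- (31)
      ((B† ∘L A†)† = A ∘L B ∘L B† ∘L A† ∘L A ∘L B) ::
      -- (32)
      ((B† ∘L A†)† = A ∘L (B† ∘L A† ∘L A)† ∧ (B† ∘L A† ∘L A)† = A† ∘L A ∘L B) ::
      -- (33)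
      ((B† ∘L A†)† = (B ∘L B† ∘L A†)† ∘L B ∧ (B ∘L B† ∘L A†)† = A ∘L B ∘L B†) ::
      -- (34)
      ((B† ∘L A†)† = A ∘L (B ∘L B† ∘L A† ∘L A)† ∘L B ∧
        (B ∘L B† ∘L A† ∘L A)† = A† ∘L A ∘L B ∘L B†) ::
      -- (35)
      (A ∘L B ∈ inverses134 (B† ∘L A†)) ::
      -- (36)
      ((B† ∘L A† ∘L (B† ∘L A†)† = B† ∘L A† ∘L A ∘L B ∧
          B† ∘L A† ∘L A ∘L B = Bᴴ ∘L A† ∘L A ∘L B†ᴴ) ∧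
        ((B† ∘L A†)† ∘L B† ∘L A† = A ∘L B ∘L B† ∘L A† ∧
          A ∘L B ∘L B† ∘L A† = A†ᴴ ∘L B ∘L B† ∘L Aᴴ)) ::
      -- (37)
      ((A ∘L B)† = (Aᴴ ∘L A ∘L B)† ∘L Aᴴ ∧ (Aᴴ ∘L A ∘L B)† = B† ∘L (Aᴴ ∘L A)†) ::
      -- (38)
      ((A ∘L B)† = Bᴴ ∘L (A ∘L B ∘L Bᴴ)† ∧ (A ∘L B ∘L Bᴴ)† = (B ∘L Bᴴ)† ∘L A†) ::
      -- (39)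
      ((A ∘L B)† = Bᴴ ∘L (Aᴴ ∘L A ∘L B ∘L Bᴴ)† ∘L Aᴴ ∧
        (Aᴴ ∘L A ∘L B ∘L Bᴴ)† = (B ∘L Bᴴ)† ∘L (Aᴴ ∘L A)†) ::
      -- (40)
      ((A ∘L B)† = ((Bᴴ ∘L B) ^ n) ∘L
          (((A ∘L Aᴴ) ^ m) ∘L A ∘L B ∘L ((Bᴴ ∘L B) ^ n))† ∘L ((A ∘L Aᴴ) ^ m) ∧
        (((A ∘L Aᴴ) ^ m) ∘L A ∘L B ∘L ((Bᴴ ∘L B) ^ n))† =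
          (B ∘L ((Bᴴ ∘L B) ^ n))† ∘L (((A ∘L Aᴴ) ^ m) ∘L A)†) ::
      -- (41)
      ((A ∘L B)† = Bᴴ ∘L ((B ∘L Bᴴ) ^ n) ∘L
          (((Aᴴ ∘L A) ^ (m + 1)) ∘L ((B ∘L Bᴴ) ^ (n + 1)))† ∘L ((Aᴴ ∘L A) ^ m) ∘L Aᴴ ∧
        (((Aᴴ ∘L A) ^ (m + 1)) ∘L ((B ∘L Bᴴ) ^ (n + 1)))† =
          ((B ∘L Bᴴ)† ^ (n + 1)) ∘L ((Aᴴ ∘L A)† ^ (m + 1))) ::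
      []) := by
  have hA := hasMoorePenrose_of_isClosed_range hA
  have hB := hasMoorePenrose_of_isClosed_range hB
  have hAB := hasMoorePenrose_of_isClosed_range hAB
  have h := mpInv_spec hA
  have k := mpInv_spec hB
  have h' := h.symm.adjoint
  have k' := k.symm.adjoint
  have a0 := Companion.self hA
  have a1 := Companion.projection hA
  have a2 := Companion.adjoint_mpInv hA
  have a3 := Companion.gram hA
  have a4 := Companion.pow_comp hA m
  have a5 := Companion.gram_pow hA m
  have b0 := Cocompanion.self hB
  have b1 := Cocompanion.projection hB
  have b2 := Cocompanion.adjoint_mpInv hB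
  have b3 := Cocompanion.gram hB
  have b4 := Cocompanion.comp_pow hB n
  have b5 := Cocompanion.gram_pow hB n
  have e11 := a1.hasMoorePenrose_comp hA hB hAB b1
  have e20 := a2.hasMoorePenrose_comp hA hB hAB b0
  have e21 := a2.hasMoorePenrose_comp hA hB hAB b1
  have e02 := a0.hasMoorePenrose_comp hA hB hAB b2
  have e12 := a1.hasMoorePenrose_comp hA hB hAB b2
  have e22 := a2.hasMoorePenrose_comp hA hB hAB b2
  -- In `eij` the index `i` tells which companion `ai` of `A` is the left factor, and `j` which
  -- cocompanion `bj` of `B` is the right factor; `dij`, `mij`, `lij`, `rij` below concern the same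
  -- product. Operators in which the order of the factors is reversed are adjoints of the previous
  -- ones.
  have d20 : Bᴴ ∘L A† = (A†ᴴ ∘L B)ᴴ := by simp only [adjoint_comp, adjoint_adjoint]
  have d02 : B† ∘L Aᴴ = (A ∘L B†ᴴ)ᴴ := by simp only [adjoint_comp, adjoint_adjoint]
  have d22 : B† ∘L A† = (A†ᴴ ∘L B†ᴴ)ᴴ := by simp only [adjoint_comp, adjoint_adjoint]
  have d12 : B† ∘L A† ∘L A = (A† ∘L A ∘L B†ᴴ)ᴴ := by
    simp only [adjoint_comp, adjoint_adjoint, comp_assoc, h.adj_a_adj_x]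
  have d21 : B ∘L B† ∘L A† = (A†ᴴ ∘L B ∘L B†)ᴴ := by
    simp only [adjoint_comp, adjoint_adjoint, comp_assoc, k.adj_x_adj_a_assoc]
  have d11 : B ∘L B† ∘L A† ∘L A = (A† ∘L A ∘L B ∘L B†)ᴴ := by
    simp only [adjoint_comp, comp_assoc, k.adj_x_adj_a_assoc, h.adj_a_adj_x]
  rw [comp_assoc] at e11 e12
  have hG2 := grevilleCondition_adjoint_mpInv_left_iff hA hB
  have hG3 := grevilleCondition_adjoint_mpInv_right_iff hA hB
  have hG4 := (grevilleCondition_adjoint_mpInv_left_iff hA k'.hasMP).trans hG3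
  refine ⟨⟨hA, hB, hAB, ?_, ?_, a0.hasMoorePenrose_comp hA hB hAB b1, e11, e20, ?_, e21, e02, ?_,
    e12, ?_, ?_, ?_, ?_, (Cocompanion.gram hA).isMoorePenrose.hasMP, a3.isMoorePenrose.hasMP,
    b3.isMoorePenrose.hasMP, (Companion.gram hB).isMoorePenrose.hasMP, ?_,
    a0.hasMoorePenrose_comp hA hB hAB b3, ?_, ?_, b4.isMoorePenrose.hasMP,
    a4.isMoorePenrose.hasMP, a5.hasMoorePenrose_comp hA hB hAB b5⟩,
    List.tfae_of_forall (GrevilleCondition A B) _ ?_⟩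
  · rw [← adjoint_comp]; exact hAB.adjoint
  · have e := a1.hasMoorePenrose_comp hA hB hAB b0
    exact e
  · rw [d20]; exact e20.adjoint
  · rw [d02]; exact e02.adjoint
  · rw [d22]; exact e22.adjoint
  · rw [d12]; exact e12.adjoint
  · rw [d21]; exact e21.adjoint
  · rw [d11]; exact e11.adjoint
  · have e := a3.hasMoorePenrose_comp hA hB hAB b0
    exact e
  · have e := a3.hasMoorePenrose_comp hA hB hAB b3
    exact e
  · have e := a4.hasMoorePenrose_comp hA hB hAB b4
    exact e
  have m20 : (Bᴴ ∘L A†)† = (A†ᴴ ∘L B)†ᴴ := by rw [d20, e20.mpInv_adjoint]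
  have m02 : (B† ∘L Aᴴ)† = (A ∘L B†ᴴ)†ᴴ := by rw [d02, e02.mpInv_adjoint]
  have m22 : (B† ∘L A†)† = (A†ᴴ ∘L B†ᴴ)†ᴴ := by rw [d22, e22.mpInv_adjoint]
  have m12 : (B† ∘L A† ∘L A)† = (A† ∘L A ∘L B†ᴴ)†ᴴ := by rw [d12, e12.mpInv_adjoint]
  have m21 : (B ∘L B† ∘L A†)† = (A†ᴴ ∘L B ∘L B†)†ᴴ := by rw [d21, e21.mpInv_adjoint]
  have m11 : (B ∘L B† ∘L A† ∘L A)† = (A† ∘L A ∘L B ∘L B†)†ᴴ := by rw [d11, e11.mpInv_adjoint]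
  have l20 : (Bᴴ ∘L A†)† ∘L Bᴴ ∘L A† = (A†ᴴ ∘L B) ∘L (A†ᴴ ∘L B)† := by
    rw [m20, d20, (mpInv_spec e20).adj_x_adj_a]
  have r20 : Bᴴ ∘L A† ∘L (Bᴴ ∘L A†)† = (A†ᴴ ∘L B)† ∘L A†ᴴ ∘L B := by
    rw [← comp_assoc, m20, d20, (mpInv_spec e20).adj_a_adj_x]
  have l02 : (B† ∘L Aᴴ)† ∘L B† ∘L Aᴴ = (A ∘L B†ᴴ) ∘L (A ∘L B†ᴴ)† := by
    rw [m02, d02, (mpInv_spec e02).adj_x_adj_a]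
  have r02 : B† ∘L Aᴴ ∘L (B† ∘L Aᴴ)† = (A ∘L B†ᴴ)† ∘L A ∘L B†ᴴ := by
    rw [← comp_assoc, m02, d02, (mpInv_spec e02).adj_a_adj_x]
  have l22 : (B† ∘L A†)† ∘L B† ∘L A† = (A†ᴴ ∘L B†ᴴ) ∘L (A†ᴴ ∘L B†ᴴ)† := by
    rw [m22, d22, (mpInv_spec e22).adj_x_adj_a]
  have r22 : B† ∘L A† ∘L (B† ∘L A†)† = (A†ᴴ ∘L B†ᴴ)† ∘L A†ᴴ ∘L B†ᴴ := by
    rw [← comp_assoc, m22, d22, (mpInv_spec e22).adj_a_adj_x]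
  -- The spaces are fixed so that each rewriting step below selects the intended equation.
  have inj₂₂ : ∀ {S T : H₂ →L[𝕜] H₂}, Sᴴ = Tᴴ ↔ S = T := EmbeddingLike.apply_eq_iff_eq _
  have inj₁₃ : ∀ {S T : H₁ →L[𝕜] H₃}, Sᴴ = Tᴴ ↔ S = T := EmbeddingLike.apply_eq_iff_eq _
  have inj₁₂ : ∀ {S T : H₁ →L[𝕜] H₂}, Sᴴ = Tᴴ ↔ S = T := EmbeddingLike.apply_eq_iff_eq _
  have inj₂₃ : ∀ {S T : H₂ →L[𝕜] H₃}, Sᴴ = Tᴴ ↔ S = T := EmbeddingLike.apply_eq_iff_eq _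
  simp only [List.forall_mem_cons]
  -- The product `A B`.
  refine ⟨mpInv_comp_iff h k hAB, comp_mpInv_comp_iff h k hAB,
    gram_comp_mpInv_comp_gram_iff h k hAB, mpInv_comp_eq_sandwich_iff h k hAB,
    mpInv_comp_eq_left_projection_iff h k hAB, mpInv_comp_eq_right_projection_iff h k hAB,
    mpInv_comp_eq_projections_iff h k hAB, mem_inverses134_iff h k hAB,
    projections_eq_iff h k hAB, ?_⟩
  -- The product `A†ᴴ B`.
  refine ⟨(mpInv_comp_iff h' k e20).trans hG2, ?_, ?_, ?_, ?_, ?_, ?_,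
    (mem_inverses134_iff h' k e20).trans hG2, ?_, ?_⟩
  · rw [← hG2, ← comp_mpInv_comp_iff h' k e20, ← inj₂₂, m20]
    simp only [adjoint_comp, adjoint_adjoint, comp_assoc, h.adj_a_adj_x, k.adj_x_adj_a_assoc]
  · rw [← hG2, ← gram_comp_mpInv_comp_gram_iff h' k e20, adjoint_adjoint]
    -- On the range of `A`, multiplication by `A Aᴴ` is inverted by `A†ᴴ A†`.
    constructor
    · intro hs
      have := congrArg (fun T => A†ᴴ ∘L A† ∘L T) hs
      simpa only [h.xax_assoc, h.x'xa_assoc] using this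
    · intro hs
      have := congrArg (fun T => A ∘L Aᴴ ∘L T) hs
      simpa only [h.adj_a_adj_x_assoc, h.axa_assoc] using this
  · rw [← hG2, ← mpInv_comp_eq_sandwich_iff h' k e20, h.adj_a_adj_x_assoc]
  · rw [← hG2, ← mpInv_comp_eq_left_projection_iff h' k e20, h.adj_a_adj_x_assoc, h.adj_a_adj_x]
  · rw [← hG2, ← mpInv_comp_eq_right_projection_iff h' k e20]
  · rw [← hG2, ← mpInv_comp_eq_projections_iff h' k e20, h.adj_a_adj_x_assoc, h.adj_a_adj_x]
  · rw [← hG2, ← projections_eq_iff h' k e20, l20, r20]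
    simp only [adjoint_adjoint, h.adj_a_adj_x_assoc]
    exact ⟨fun ⟨⟨a, b⟩, c⟩ => ⟨⟨a.trans b, b.symm⟩, c⟩,
      fun ⟨⟨a, b⟩, c⟩ => ⟨⟨a.trans b, b.symm⟩, c⟩⟩
  -- The product `A B†ᴴ`.
  refine ⟨(mpInv_comp_iff h k' e02).trans hG3, ?_, ?_, ?_, ?_, ?_, ?_,
    (mem_inverses134_iff h k' e02).trans hG3, ?_, ?_⟩
  · rw [← hG3, ← comp_mpInv_comp_iff h k' e02, k.adj_x_adj_a_assoc]
  · rw [← hG3, ← gram_comp_mpInv_comp_gram_iff h k' e02, adjoint_adjoint]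
    -- Right multiplication by `Bᴴ B` is inverted by right multiplication by `B† B†ᴴ`.
    constructor
    · intro hs
      have := congrArg (fun T => T ∘L B† ∘L B†ᴴ) hs
      simpa only [comp_assoc, k.xax_assoc, k.axx'] using this
    · intro hs
      have := congrArg (fun T => T ∘L Bᴴ ∘L B) hs
      simpa only [comp_assoc, k.adj_x_adj_a_assoc, k.xax_assoc, k.axa] using this
  · rw [← hG3, ← mpInv_comp_eq_sandwich_iff h k' e02, k.adj_x_adj_a_assoc]
  · rw [← hG3, ← mpInv_comp_eq_left_projection_iff h k' e02]
  · rw [← hG3, ← mpInv_comp_eq_right_projection_iff h k' e02, k.adj_x_adj_a_assoc, k.adj_x_adj_a]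
  · rw [← hG3, ← mpInv_comp_eq_projections_iff h k' e02, k.adj_x_adj_a_assoc, k.adj_x_adj_a]
  · rw [← hG3, ← projections_eq_iff h k' e02, l02, r02]
    simp only [adjoint_adjoint, k.adj_x_adj_a_assoc]
    exact ⟨fun ⟨c, ⟨a, b⟩⟩ => ⟨c, ⟨a.trans b, b.symm⟩⟩,
      fun ⟨c, ⟨a, b⟩⟩ => ⟨c, ⟨a.trans b, b.symm⟩⟩⟩
  -- The product `A†ᴴ B†ᴴ`, whose adjoint is `B† A†`.
  refine ⟨?_, ?_, ?_, ?_, ?_, ?_, ?_, ?_, ?_, ?_⟩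
  · rw [← hG4, ← mpInv_comp_iff h' k' e22, m22, ← inj₁₃]
    simp only [adjoint_comp, adjoint_adjoint]
  · rw [← hG4, ← comp_mpInv_comp_iff h' k' e22, m22, ← inj₂₂]
    simp only [adjoint_comp, adjoint_adjoint, comp_assoc, h.adj_a_adj_x, k.adj_x_adj_a_assoc]
  · rw [← hG4, ← gram_comp_mpInv_comp_gram_iff h' k' e22, adjoint_adjoint, adjoint_adjoint,
      (Cocompanion.gram hA).isMoorePenrose.mpInv_eq, (Companion.gram hB).isMoorePenrose.mpInv_eq,
      comp_assoc]
  · rw [← hG4, ← mpInv_comp_eq_sandwich_iff h' k' e22, m22, ← inj₁₃]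
    simp only [adjoint_comp, adjoint_adjoint, comp_assoc, h.adj_a_adj_x_assoc,
      k.adj_x_adj_a_assoc]
  · rw [← hG4, ← mpInv_comp_eq_left_projection_iff h' k' e22, m22, m12, ← inj₁₃, ← inj₁₂]
    simp only [adjoint_comp, adjoint_adjoint, comp_assoc, h.adj_a_adj_x_assoc, h.adj_a_adj_x]
  · rw [← hG4, ← mpInv_comp_eq_right_projection_iff h' k' e22, m22, m21, ← inj₁₃, ← inj₂₃]
    simp only [adjoint_comp, adjoint_adjoint, comp_assoc, k.adj_x_adj_a_assoc, k.adj_x_adj_a]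
  · rw [← hG4, ← mpInv_comp_eq_projections_iff h' k' e22, m22, m11, ← inj₁₃, ← inj₂₂]
    simp only [adjoint_comp, adjoint_adjoint, comp_assoc, h.adj_a_adj_x_assoc, h.adj_a_adj_x,
      k.adj_x_adj_a_assoc, k.adj_x_adj_a]
  · rw [← hG4, ← mem_inverses134_iff h' k' e22, d22, ← adjoint_mem_inverses134_adjoint_iff,
      adjoint_adjoint, adjoint_comp]
  · rw [← hG4, ← projections_eq_iff h' k' e22, l22, r22]
    simp only [adjoint_adjoint, h.adj_a_adj_x_assoc, k.adj_x_adj_a_assoc]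
    exact ⟨fun ⟨⟨a, b⟩, c, d⟩ => ⟨⟨c.trans d, d.symm⟩, a.trans b, b.symm⟩,
      fun ⟨⟨a, b⟩, c, d⟩ => ⟨⟨c.trans d, d.symm⟩, a.trans b, b.symm⟩⟩
  -- Gram operators and their powers: the two equations together collapse to `(A B)† = B† A†`, and
  -- conversely that law passes to the products of the companions.
  have gA := a3.isMoorePenrose.mpInv_eq
  have gB := b3.isMoorePenrose.mpInv_eq
  have hG1 := mpInv_comp_iff h k hAB
  refine ⟨?_, ?_, ?_, ?_, ?_, fun _ hp => absurd hp List.not_mem_nil⟩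
  · rw [← hG1]
    refine ⟨fun ⟨p, q⟩ => ?_, fun p => ?_⟩
    · rw [p, q, gA]
      simp only [comp_assoc, h.adj_x_adj_a, h.xax]
    · have q := (hG1.1 p).mpInv_comp hA hB a3 b0
      rw [comp_assoc] at q
      rw [p, q, gA]
      simp only [comp_assoc, h.adj_x_adj_a, h.xax, and_self]
  · rw [← hG1]
    refine ⟨fun ⟨p, q⟩ => ?_, fun p => ?_⟩
    · rw [p, q, gB]
      simp only [comp_assoc, k.adj_a_adj_x_assoc, k.xax_assoc]
    · have q := (hG1.1 p).mpInv_comp hA hB a0 b3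
      rw [p, q, gB]
      simp only [comp_assoc, k.adj_a_adj_x_assoc, k.xax_assoc, and_self]
  · rw [← hG1]
    refine ⟨fun ⟨p, q⟩ => ?_, fun p => ?_⟩
    · rw [p, q, gA, gB]
      simp only [comp_assoc, h.adj_x_adj_a, h.xax, k.adj_a_adj_x_assoc, k.xax_assoc]
    · have q := (hG1.1 p).mpInv_comp hA hB a3 b3
      rw [comp_assoc] at q
      rw [p, q, gA, gB]
      simp only [comp_assoc, h.adj_x_adj_a, h.xax, k.adj_a_adj_x_assoc, k.xax_assoc, and_self]
  · rw [a4.isMoorePenrose.mpInv_eq, b4.isMoorePenrose.mpInv_eq, ← hG1]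
    have key : ((Bᴴ ∘L B) ^ n) ∘L ((((B† ∘L B†ᴴ) ^ n) ∘L B†) ∘L A† ∘L ((A†ᴴ ∘L A†) ^ m)) ∘L
        ((A ∘L Aᴴ) ^ m) = B† ∘L A† := by
      have e := congrArg₂ (fun S T => S ∘L T) (k.pow_comp_pow_comp n) (h.comp_pow_comp_pow m)
      simpa only [comp_assoc] using e
    refine ⟨fun ⟨p, q⟩ => ?_, fun p => ?_⟩
    · rw [p, q]
      exact key
    · have q := (hG1.1 p).mpInv_comp hA hB a4 b4
      rw [comp_assoc] at q
      rw [p, q]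
      exact ⟨key.symm, rfl⟩
  · rw [gA, gB, ← hG1]
    have key : Bᴴ ∘L ((B ∘L Bᴴ) ^ n) ∘L (((B†ᴴ ∘L B†) ^ (n + 1)) ∘L ((A† ∘L A†ᴴ) ^ (m + 1))) ∘L
        ((Aᴴ ∘L A) ^ m) ∘L Aᴴ = B† ∘L A† := by
      have e := congrArg₂ (fun S T => (Bᴴ ∘L S) ∘L (T ∘L Aᴴ)) (k.pow_comp_gram_pow_succ n)
        (h.gram_pow_succ_comp_pow m)
      simp only [comp_assoc, k.adj_a_adj_x_assoc, k.xax_assoc, h.adj_x_adj_a, h.xax] at e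
      exact e
    refine ⟨fun ⟨p, q⟩ => ?_, fun p => ?_⟩
    · rw [p, q]
      exact key
    · have q := (hG1.1 p).mpInv_comp hA hB a5 b5
      rw [p, q]
      exact ⟨key.symm, rfl⟩
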